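/- Let $k$ be a field and let $\mathcal C$ be a skeletally small, Hom-finite, Krull-Schmidt, triangulated $k$-category with suspension functor $\Sigma$ and with a Serre duality, i.e. an autoequivalence $\nu\colon\mathcal C\to\mathcal C$ together with $k$-linear isomorphisms $\operatorname{Hom}_{\mathcal C}(X,Y)\simeq \operatorname{Hom}_k(\operatorname{Hom}_{\mathcal C}(Y,\nu X),k)$ natural in $X$ and $Y$. Let $T$ be a rigid object of $\mathcal C$, i.e. $\operatorname{Hom}_{\mathcal C}(T,\Sigma T)=0$. Let $\mathcal X_T$ be the class of objects $X$ of $\mathcal C$ with $\operatorname{Hom}_{\mathcal C}(T,X)=0$, and let $\mathcal C/\mathcal X_T$ be the category with the same objects as $\mathcal C$ whose morphisms are those of $\mathcal C$ modulo the morphisms that factor through an object of $\mathcal X_T$. Then the category $\mathcal C/\mathcal X_T$ is integral. That is, it is preabelian (an additive category in which every morphism has a kernel and a cokernel), and for all commutative squares $$\begin{array}{ccc} A & \xrightarrow{\;a\;} & B\\ {\scriptstyle b}\downarrow & & \downarrow{\scriptstyle c}\\ C & \xrightarrow{\;d\;} & D\end{array}$$ in $\mathcal C/\mathcal X_T$: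 if the square is a pullback and $d$ is an epimorphism, then $a$ is an epimorphism; and if the square is a pushout and $a$ is a monomorphism, then $d$ is a monomorphism. -/

import Mathlib

open CategoryTheory CategoryTheory.Limits CategoryTheory.Pretriangulated

universe v u w

/-- A Krull-Schmidt category: every object is a finite direct sum of objects with local
endomorphism rings. -/
def IsKrullSchmidt (C : Type u) [Category.{v} C] [Preadditive C] [HasFiniteBiproducts C] : Prop :=
  ∀ X : C, ∃ (n : ℕ) (Y : Fin n → C),
    (∀ i, IsLocalRing (End (Y i))) ∧ Nonempty (X ≅ ⨁ Y)

/-- A Serre duality on a `k`-linear category: an autoequivalence `ν` together with `k`-linear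
isomorphisms `Hom(X, Y) ≃ D Hom(Y, ν X)`, natural in `X` and `Y`, where `D = Hom_k(-, k)`. -/
structure SerreDuality (k : Type w) [Field k] (C : Type u) [Category.{v} C] [Preadditive C]
    [Linear k C] where
  /-- the autoequivalence -/
  ν : C ≌ C
  /-- the duality isomorphism -/
  iso (X Y : C) : (X ⟶ Y) ≃ₗ[k] Module.Dual k (Y ⟶ ν.functor.obj X)
  /-- naturality in the first variable -/
  naturality_left {X' X Y : C} (f : X' ⟶ X) (g : X ⟶ Y) (h : Y ⟶ ν.functor.obj X') :
    iso X' Y (f ≫ g) h = iso X Y g (h ≫ ν.functor.map f)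
  /-- naturality in the second variable -/
  naturality_right {X Y Y' : C} (g : X ⟶ Y) (e : Y ⟶ Y') (h : Y' ⟶ ν.functor.obj X) :
    iso X Y' (g ≫ e) h = iso X Y g (e ≫ h)

/-- `T` is rigid: `Ext¹(T, T) = Hom(T, ΣT) = 0`. -/
def IsRigidObject {C : Type u} [Category.{v} C] [Preadditive C] [HasShift C ℤ] (T : C) : Prop :=
  ∀ f : T ⟶ T⟦(1 : ℤ)⟧, f = 0

section FactorCategory

variable {C : Type u} [Category.{v} C] [Preadditive C]

/-- The class `X_T` of the objects `X` with `Hom(T, X) = 0`. -/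
def homKernel (T : C) : ObjectProperty C := fun X => ∀ f : T ⟶ X, f = 0

/-- The morphism `f` factors through an object of `X_T`. -/
def FactorsThroughHomKernel (T : C) {X Y : C} (f : X ⟶ Y) : Prop :=
  ∃ (U : C) (_ : homKernel T U) (a : X ⟶ U) (b : U ⟶ Y), f = a ≫ b

/-- Two parallel morphisms are identified when their difference factors through `X_T`. -/
def factorRel (T : C) : HomRel C := fun _ _ f g => FactorsThroughHomKernel T (f - g)

lemma FactorsThroughHomKernel.add [HasBinaryBiproducts C] {T X Y : C} {f g : X ⟶ Y}
    (hf : FactorsThroughHomKernel T f) (hg : FactorsThroughHomKernel T g) :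
    FactorsThroughHomKernel T (f + g) := by
  obtain ⟨U, hU, a, b, rfl⟩ := hf
  obtain ⟨V, hV, c, d, rfl⟩ := hg
  refine ⟨U ⊞ V, ?_, biprod.lift a c, biprod.desc b d, by simp⟩
  intro t
  apply biprod.hom_ext
  · rw [hU (t ≫ biprod.fst), zero_comp]
  · rw [hV (t ≫ biprod.snd), zero_comp]

lemma FactorsThroughHomKernel.zero [HasZeroObject C] (T X Y : C) :
    FactorsThroughHomKernel T (0 : X ⟶ Y) :=
  ⟨(HasZeroObject.zero' C).zero, fun _ => (isZero_zero C).eq_of_tgt _ _, 0, 0, by simp⟩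

variable [HasZeroObject C] [HasBinaryBiproducts C]

instance factorRel_congruence (T : C) : Congruence (factorRel T) where
  equivalence :=
    { refl := fun f => by
        simpa [factorRel] using FactorsThroughHomKernel.zero T _ _
      symm := by
        rintro f g ⟨U, hU, a, b, h⟩
        exact ⟨U, hU, -a, b, by rw [Preadditive.neg_comp, ← h, neg_sub]⟩
      trans := by
        intro f g h h₁ h₂
        have := FactorsThroughHomKernel.add h₁ h₂
        rwa [sub_add_sub_cancel] at this }
  comp_left := by
    rintro X Y Z f g g' ⟨U, hU, a, b, h⟩
    exact ⟨U, hU, f ≫ a, b, by rw [← Preadditive.comp_sub, h, Category.assoc]⟩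
  comp_right := by
    rintro X Y Z f f' g ⟨U, hU, a, b, h⟩
    exact ⟨U, hU, a, b ≫ g, by rw [← Preadditive.sub_comp, h, Category.assoc]⟩

lemma factorRel_add (T : C) ⦃X Y : C⦄ (f₁ f₂ g₁ g₂ : X ⟶ Y)
    (hf : factorRel T f₁ f₂) (hg : factorRel T g₁ g₂) :
    factorRel T (f₁ + g₁) (f₂ + g₂) := by
  have := FactorsThroughHomKernel.add hf hg
  rwa [sub_add_sub_comm] at this

/-- The factor category `C / X_T`: the objects are those of `C`, and the morphisms are those of `C`
modulo the morphisms factoring through `X_T`. -/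
abbrev FactorCategory (T : C) := Quotient (factorRel T)

/-- The additive structure on the morphisms of `C / X_T` induced by that of `C`. -/
instance factorCategoryPreadditive (T : C) : Preadditive (FactorCategory T) :=
  Quotient.preadditive (factorRel T) (factorRel_add T)

end FactorCategory

section Integral

variable (A : Type u) [Category.{v} A]

/-- A preabelian category: an additive category in which every morphism has a kernel and a
cokernel. -/
structure IsPreabelian [Preadditive A] : Prop where
  hasFiniteBiproducts : HasFiniteBiproducts A
  hasKernels : HasKernels A
  hasCokernels : HasCokernels A

/-- In every pullback square, the base change `a` of an epimorphism `d` is an epimorphism. -/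
def PullbacksPreserveEpi : Prop :=
  ∀ ⦃P B X D : A⦄ (a : P ⟶ B) (b : P ⟶ X) (c : B ⟶ D) (d : X ⟶ D),
    IsPullback a b c d → Epi d → Epi a

/-- In every pushout square, the cobase change `d` of a monomorphism `a` is a monomorphism. -/
def PushoutsPreserveMono : Prop :=
  ∀ ⦃P B X D : A⦄ (a : P ⟶ B) (b : P ⟶ X) (c : B ⟶ D) (d : X ⟶ D),
    IsPushout a b c d → Mono a → Mono d

/-- An integral category: a preabelian category which is left integral and right integral. -/
structure IsIntegralCategory [Preadditive A] : Prop where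
  preabelian : IsPreabelian A
  leftIntegral : PullbacksPreserveEpi A
  rightIntegral : PushoutsPreserveMono A

end Integral

/-!
For rigid `T`, the cone of a right approximation of `X` by copies of `T` lies in `X_T`; hence a
morphism vanishes in `C / X_T` as soon as `Hom(T, -)` kills it, and `T` is a separator of `C / X_T`.
By Serre duality, `S = ν T` is a coseparator.

To find a kernel of `f : X ⟶ Y` in `C / X_T`, compose `f` with a left approximation of `Y` by copies
of `S`, which is a monomorphism in `C / X_T`, and complete the composite `X ⟶ S^n` to a triangle
`K ⟶ X ⟶ S^n ⟶`. As `Hom(ΣT, S)` is dual to `Hom(T, ΣT) = 0`, the morphism `K ⟶ X` is a monomorphism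
in `C / X_T`. The same triangle shows that a morphism `X ⟶ S` vanishing on `K` extends along `f`,
and this strong injectivity of the coseparator `S` makes epimorphisms stable under pullback.
Cokernels and pushouts are treated dually.
-/

lemma PullbacksPreserveEpi.unop {A : Type*} [Category* A] (h : PullbacksPreserveEpi Aᵒᵖ) :
    PushoutsPreserveMono A := fun _ _ _ _ _ _ _ d sq _ =>
  have := h _ _ _ _ sq.op inferInstance
  unop_mono_of_epi d.op

section Preadditive

variable {A : Type*} [Category* A] [Preadditive A]

/-- An object `P` which is projective in the strong sense that, for every `f : X ⟶ Y`, a morphism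
`P ⟶ Y` killed by the cokernel of `f` lifts along `f`. Being killed by the cokernel is phrased
without assuming that it exists. -/
def IsCokernelProjective (P : A) : Prop :=
  ∀ ⦃X Y : A⦄ (f : X ⟶ Y) (g : P ⟶ Y),
    (∀ ⦃W : A⦄ (w : Y ⟶ W), f ≫ w = 0 → g ≫ w = 0) → ∃ e : P ⟶ X, e ≫ f = g

/-- An object `I` which is injective in the strong sense that, for every `f : X ⟶ Y`, a morphism
`X ⟶ I` vanishing on the kernel of `f` extends along `f`. Vanishing on the kernel is phrased
without assuming that it exists. -/
def IsKernelInjective (I : A) : Prop :=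
  ∀ ⦃X Y : A⦄ (f : X ⟶ Y) (g : X ⟶ I),
    (∀ ⦃W : A⦄ (w : W ⟶ X), w ≫ f = 0 → w ≫ g = 0) → ∃ e : Y ⟶ I, f ≫ e = g

lemma IsCokernelProjective.op {P : A} (hP : IsCokernelProjective P) :
    IsKernelInjective (Opposite.op P) := fun _ _ f g hfg => by
  obtain ⟨e, he⟩ := hP f.unop g.unop fun _ w hw =>
    Quiver.Hom.op_inj (hfg w.op (Quiver.Hom.unop_inj hw))
  exact ⟨e.op, Quiver.Hom.unop_inj he⟩

lemma mono_of_isSeparator {G : A} (hG : IsSeparator G) {X Y : A} (f : X ⟶ Y)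
    (hf : ∀ t : G ⟶ X, t ≫ f = 0 → t = 0) : Mono f :=
  Preadditive.mono_of_cancel_zero f fun g hg =>
    (Preadditive.isSeparator_iff G).1 hG g fun t => hf _ (by rw [Category.assoc, hg, comp_zero])

lemma epi_of_isCoseparator {G : A} (hG : IsCoseparator G) {X Y : A} (f : X ⟶ Y)
    (hf : ∀ s : Y ⟶ G, f ≫ s = 0 → s = 0) : Epi f :=
  Preadditive.epi_of_cancel_zero f fun g hg =>
    (Preadditive.isCoseparator_iff G).1 hG g fun s =>
      hf _ (by rw [← Category.assoc, hg, zero_comp])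

lemma pullbacksPreserveEpi_of_isCoseparator [HasBinaryBiproducts A] {I : A}
    (hI : IsCoseparator I) (hI' : IsKernelInjective I) : PullbacksPreserveEpi A := by
  intro P B X D a b c d sq _
  refine epi_of_isCoseparator hI a fun s has => ?_
  -- As `P` is the kernel of `(c, -d) : B ⊞ X ⟶ D`, the morphism `(s, 0)` extends to `D`.
  obtain ⟨e, he⟩ : ∃ e : D ⟶ I, biprod.desc c (-d) ≫ e = biprod.fst ≫ s := by
    refine hI' _ _ fun W w hw => ?_
    have comm : (w ≫ biprod.fst) ≫ c = (w ≫ biprod.snd) ≫ d := by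
      simpa [biprod.desc_eq, ← sub_eq_add_neg, sub_eq_zero] using hw
    rw [← Category.assoc, ← sq.lift_fst _ _ comm, Category.assoc, has, comp_zero]
  have hce : c ≫ e = s := by simpa using biprod.inl ≫= he
  have hde : d ≫ e = 0 := by simpa using biprod.inr ≫= he
  rw [← hce, zero_of_epi_comp d hde, comp_zero]

lemma pushoutsPreserveMono_of_isSeparator [HasBinaryBiproducts A] {P : A}
    (hP : IsSeparator P) (hP' : IsCokernelProjective P) : PushoutsPreserveMono A :=
  (pullbacksPreserveEpi_of_isCoseparator ((isCoseparator_op_iff P).2 hP) hP'.op).unop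

end Preadditive

section Approximation

variable (R : Type*) [Ring R] {C : Type*} [Category* C] [Preadditive C] [Linear R C]
  [HasFiniteBiproducts C]

lemma exists_right_approximation (T X : C) [Module.Finite R (T ⟶ X)] :
    ∃ (n : ℕ) (p : (⨁ fun _ : Fin n => T) ⟶ X), ∀ t : T ⟶ X, ∃ t', t' ≫ p = t := by
  obtain ⟨n, b, hb⟩ := Module.Finite.exists_fin (R := R) (M := T ⟶ X)
  refine ⟨n, biproduct.desc b, fun t => ?_⟩
  obtain ⟨r, rfl⟩ := (Submodule.mem_span_range_iff_exists_fun R).1 (hb ▸ Submodule.mem_top (x := t))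
  exact ⟨biproduct.lift fun i => r i • 𝟙 T, by simp [biproduct.lift_desc]⟩

lemma exists_left_approximation (S X : C) [Module.Finite R (X ⟶ S)] :
    ∃ (n : ℕ) (j : X ⟶ ⨁ fun _ : Fin n => S), ∀ s : X ⟶ S, ∃ s', j ≫ s' = s := by
  obtain ⟨n, b, hb⟩ := Module.Finite.exists_fin (R := R) (M := X ⟶ S)
  refine ⟨n, biproduct.lift b, fun s => ?_⟩
  obtain ⟨r, rfl⟩ := (Submodule.mem_span_range_iff_exists_fun R).1 (hb ▸ Submodule.mem_top (x := s))
  exact ⟨biproduct.desc fun i => r i • 𝟙 S, by simp [biproduct.lift_desc]⟩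

end Approximation

section AdditiveFunctor

variable {C D : Type*} [Category* C] [Category* D] [Preadditive C] [Preadditive D]
  [HasFiniteBiproducts C] (F : C ⥤ D) [F.Additive] {n : ℕ} {Y : Fin n → C} {X : D}

lemma eq_zero_of_comp_map_biproduct_π (f : X ⟶ F.obj (⨁ Y))
    (hf : ∀ i, f ≫ F.map (biproduct.π Y i) = 0) : f = 0 :=
  (isBilimitOfPreserves F (biproduct.isBilimit Y)).isLimit.hom_ext fun i =>
    (hf i.as).trans zero_comp.symm

lemma eq_zero_of_map_biproduct_ι_comp (f : F.obj (⨁ Y) ⟶ X)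
    (hf : ∀ i, F.map (biproduct.ι Y i) ≫ f = 0) : f = 0 :=
  (isBilimitOfPreserves F (biproduct.isBilimit Y)).isColimit.hom_ext fun i =>
    (hf i.as).trans comp_zero.symm

end AdditiveFunctor

section SerreTrace

/-- A linear form `τ` on `Hom(T, S)` for which the pairings `Hom(T, Y) × Hom(Y, S) → k`,
`(t, s) ↦ τ (t ≫ s)`, are nondegenerate. Under a Serre duality, the linear form on `Hom(T, ν T)`
corresponding to the identity of `T` is one. -/
structure IsSerreTrace {k : Type*} [CommRing k] {C : Type*} [Category* C] [Preadditive C]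
    [Linear k C] {T S : C} (τ : Module.Dual k (T ⟶ S)) : Prop where
  eq_zero_left ⦃Y : C⦄ (t : T ⟶ Y) : (∀ s : Y ⟶ S, τ (t ≫ s) = 0) → t = 0
  eq_zero_right ⦃Y : C⦄ (s : Y ⟶ S) : (∀ t : T ⟶ Y, τ (t ≫ s) = 0) → s = 0

lemma SerreDuality.isSerreTrace {k : Type w} [Field k] {C : Type u} [Category.{v} C]
    [Preadditive C] [Linear k C] (D : SerreDuality k C) (T : C) :
    IsSerreTrace (D.iso T T (𝟙 T)) := by
  have trace_comp {Y : C} (t : T ⟶ Y) (s : Y ⟶ D.ν.functor.obj T) :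
      D.iso T T (𝟙 T) (t ≫ s) = D.iso T Y t s := by
    rw [← D.naturality_right, Category.id_comp]
  refine ⟨fun Y t ht => (D.iso T Y).injective ?_, fun Y s hs => ?_⟩
  · ext s
    rw [← trace_comp, ht, map_zero, LinearMap.zero_apply]
  · rw [← Module.forall_dual_apply_eq_zero_iff k]
    intro φ
    obtain ⟨t, rfl⟩ := (D.iso T Y).surjective φ
    rw [← trace_comp, hs]

namespace IsSerreTrace

variable {k : Type*} [CommRing k] {C : Type*} [Category* C] [Preadditive C] [Linear k C] {T S : C}
  {τ : Module.Dual k (T ⟶ S)} (hτ : IsSerreTrace τ)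

include hτ

lemma eq_zero_of_forall_hom_eq_zero {Y : C} (hY : ∀ t : T ⟶ Y, t = 0) (s : Y ⟶ S) : s = 0 :=
  hτ.eq_zero_right s fun t => by rw [hY t, zero_comp, map_zero]

lemma comp_eq_zero_of_forall_comp_eq_zero {X Y : C} {f : X ⟶ Y} (hf : ∀ s : Y ⟶ S, f ≫ s = 0)
    (t : T ⟶ X) : t ≫ f = 0 :=
  hτ.eq_zero_left _ fun s => by rw [Category.assoc, hf, comp_zero, map_zero]

lemma finite_hom [IsNoetherianRing k] (Y : C) [Module.Finite k (T ⟶ Y)] :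
    Module.Finite k (Y ⟶ S) := by
  let pairing : (Y ⟶ S) →ₗ[k] Module.Dual k (T ⟶ Y) := ((Linear.comp T Y S).compr₂ τ).flip
  refine Module.Finite.of_injective pairing ((injective_iff_map_eq_zero pairing).2 fun s hs => ?_)
  exact hτ.eq_zero_right s fun t => LinearMap.congr_fun hs t

end IsSerreTrace

end SerreTrace

section FactorCategory

variable {C : Type u} [Category.{v} C] [Preadditive C] [HasFiniteBiproducts C]

attribute [local instance] hasBinaryBiproducts_of_finite_biproducts

/-- The projection functor `C ⥤ C / X_T`. -/
abbrev toFactorCategory (T : C) : C ⥤ FactorCategory T := Quotient.functor (factorRel T)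

instance toFactorCategory_additive (T : C) : (toFactorCategory T).Additive :=
  Quotient.functor_additive _ (factorRel_add T)

lemma hasFiniteBiproducts_factorCategory (T : C) : HasFiniteBiproducts (FactorCategory T) where
  out _ :=
    { has_biproduct := fun F =>
        inferInstanceAs (HasBiproduct fun i => (toFactorCategory T).obj (F i).as) }

variable {T : C} {X Y : C} {n : ℕ}

lemma toFactorCategory_map_eq_zero_iff (f : X ⟶ Y) :
    (toFactorCategory T).map f = 0 ↔ FactorsThroughHomKernel T f := by
  refine (Quotient.functor_map_eq_iff (factorRel T) f 0).trans ?_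
  simp only [factorRel, sub_zero]

lemma eq_zero_of_toFactorCategory_map_eq_zero {t : T ⟶ X}
    (ht : (toFactorCategory T).map t = 0) : t = 0 := by
  obtain ⟨U, hU, a, b, rfl⟩ := (toFactorCategory_map_eq_zero_iff t).1 ht
  rw [hU a, zero_comp]

lemma eq_zero_of_toFactorCategory_map_eq_zero_of_biproduct {f : (⨁ fun _ : Fin n => T) ⟶ X}
    (hf : (toFactorCategory T).map f = 0) : f = 0 :=
  biproduct.hom_ext' _ _ fun i => by
    rw [comp_zero]
    exact eq_zero_of_toFactorCategory_map_eq_zero (by rw [Functor.map_comp, hf, comp_zero])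

namespace IsSerreTrace

variable {k : Type*} [CommRing k] [Linear k C] {S : C} {τ : Module.Dual k (T ⟶ S)}

lemma eq_zero_of_map_eq_zero (hτ : IsSerreTrace τ) {s : X ⟶ S}
    (hs : (toFactorCategory T).map s = 0) : s = 0 := by
  obtain ⟨U, hU, a, b, rfl⟩ := (toFactorCategory_map_eq_zero_iff s).1 hs
  rw [hτ.eq_zero_of_forall_hom_eq_zero hU b, comp_zero]

lemma eq_zero_of_map_eq_zero_of_biproduct (hτ : IsSerreTrace τ) {f : X ⟶ ⨁ fun _ : Fin n => S}
    (hf : (toFactorCategory T).map f = 0) : f = 0 :=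
  biproduct.hom_ext _ _ fun i => by
    rw [zero_comp]
    exact hτ.eq_zero_of_map_eq_zero (by rw [Functor.map_comp, hf, zero_comp])

end IsSerreTrace

end FactorCategory

section Rigid

variable {C : Type u} [Category.{v} C] [Preadditive C] [HasZeroObject C] [HasShift C ℤ]
  [∀ n : ℤ, (shiftFunctor C n).Additive] [Pretriangulated C] {T : C}

section Separator

variable {R : Type*} [Ring R] [Linear R C]

lemma toFactorCategory_map_eq_zero_of_forall_comp_eq_zero (hT : IsRigidObject T) {X Y : C}
    [Module.Finite R (T ⟶ X)] {f : X ⟶ Y} (hf : ∀ t : T ⟶ X, t ≫ f = 0) :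
    (toFactorCategory T).map f = 0 := by
  -- The cone of a right approximation of `X` by copies of `T` lies in `X_T`.
  obtain ⟨n, p, hp⟩ := exists_right_approximation R T X
  obtain ⟨U, q, r, hd⟩ := distinguished_cocone_triangle p
  have hpq : p ≫ q = 0 := comp_distTriang_mor_zero₁₂ _ hd
  have hU : homKernel T U := fun u => by
    have hur : u ≫ r = 0 :=
      eq_zero_of_comp_map_biproduct_π (shiftFunctor C (1 : ℤ)) _ fun _ => hT _
    obtain ⟨x, rfl⟩ : ∃ x : T ⟶ X, u = x ≫ q := Triangle.coyoneda_exact₃ _ hd u hur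
    obtain ⟨x, rfl⟩ := hp x
    rw [Category.assoc, hpq, comp_zero]
  have hpf : p ≫ f = 0 := biproduct.hom_ext' _ _ fun i => by rw [← Category.assoc, hf, comp_zero]
  obtain ⟨g, hg⟩ : ∃ g : U ⟶ Y, f = q ≫ g := Triangle.yoneda_exact₂ _ hd f hpf
  exact (toFactorCategory_map_eq_zero_iff f).2 ⟨U, hU, q, g, hg⟩

lemma isSeparator_toFactorCategory_obj (hfin : ∀ X : C, Module.Finite R (T ⟶ X))
    (hT : IsRigidObject T) : IsSeparator ((toFactorCategory T).obj T) := by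
  refine (Preadditive.isSeparator_iff _).2 ?_
  rintro ⟨X⟩ ⟨Y⟩ f hf
  obtain ⟨f, rfl⟩ := (toFactorCategory T).map_surjective f
  refine toFactorCategory_map_eq_zero_of_forall_comp_eq_zero (R := R) hT fun t => ?_
  exact eq_zero_of_toFactorCategory_map_eq_zero (by rw [Functor.map_comp, hf])

lemma exists_epi_toFactorCategory_map (hfin : ∀ X : C, Module.Finite R (T ⟶ X))
    (hT : IsRigidObject T) (X : C) :
    ∃ (n : ℕ) (p : (⨁ fun _ : Fin n => T) ⟶ X), Epi ((toFactorCategory T).map p) := by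
  obtain ⟨n, p, hp⟩ := exists_right_approximation R T X
  refine ⟨n, p, Preadditive.epi_of_cancel_zero _ ?_⟩
  rintro ⟨W⟩ w hw
  obtain ⟨w, rfl⟩ := (toFactorCategory T).map_surjective w
  rw [← Functor.map_comp] at hw
  refine toFactorCategory_map_eq_zero_of_forall_comp_eq_zero (R := R) hT fun t => ?_
  obtain ⟨t, rfl⟩ := hp t
  rw [Category.assoc, eq_zero_of_toFactorCategory_map_eq_zero_of_biproduct hw, comp_zero]

lemma isCokernelProjective_toFactorCategory_obj (hfin : ∀ X : C, Module.Finite R (T ⟶ X))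
    (hT : IsRigidObject T) : IsCokernelProjective ((toFactorCategory T).obj T) := by
  rintro ⟨X⟩ ⟨Y⟩ f g hfg
  obtain ⟨f, rfl⟩ := (toFactorCategory T).map_surjective f
  obtain ⟨g, rfl⟩ := (toFactorCategory T).map_surjective g
  obtain ⟨n, p, _⟩ := exists_epi_toFactorCategory_map hfin hT X
  obtain ⟨Q, q, r, hd⟩ := distinguished_cocone_triangle (p ≫ f)
  have hpfq : (p ≫ f) ≫ q = 0 := comp_distTriang_mor_zero₁₂ _ hd
  have hfq : (toFactorCategory T).map f ≫ (toFactorCategory T).map q = 0 := by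
    apply zero_of_epi_comp ((toFactorCategory T).map p)
    rw [← Category.assoc, ← Functor.map_comp, ← Functor.map_comp, hpfq, Functor.map_zero]
  have hgq : g ≫ q = 0 :=
    eq_zero_of_toFactorCategory_map_eq_zero (by rw [Functor.map_comp, hfg _ hfq])
  obtain ⟨e, rfl⟩ : ∃ e, g = e ≫ p ≫ f := Triangle.coyoneda_exact₂ _ hd g hgq
  exact ⟨(toFactorCategory T).map (e ≫ p), by rw [← Functor.map_comp, Category.assoc]⟩

end Separator

namespace IsSerreTrace

variable {k : Type*} [CommRing k] [Linear k C] {S : C} {τ : Module.Dual k (T ⟶ S)}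
  (hτ : IsSerreTrace τ) (hfin : ∀ X : C, Module.Finite k (T ⟶ X)) (hT : IsRigidObject T)

include hτ hfin hT

lemma isCoseparator_toFactorCategory_obj : IsCoseparator ((toFactorCategory T).obj S) := by
  refine (Preadditive.isCoseparator_iff _).2 ?_
  rintro ⟨X⟩ ⟨Y⟩ f hf
  obtain ⟨f, rfl⟩ := (toFactorCategory T).map_surjective f
  refine toFactorCategory_map_eq_zero_of_forall_comp_eq_zero (R := k) hT <|
    hτ.comp_eq_zero_of_forall_comp_eq_zero fun s => ?_
  exact hτ.eq_zero_of_map_eq_zero (by rw [Functor.map_comp, hf])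

lemma mono_map_of_distTriang {K X : C} {n : ℕ} {i : K ⟶ X} {p : X ⟶ ⨁ fun _ : Fin n => S}
    {r : (⨁ fun _ : Fin n => S) ⟶ K⟦(1 : ℤ)⟧} (hd : Triangle.mk i p r ∈ distTriang C) :
    Mono ((toFactorCategory T).map i) := by
  refine mono_of_isSeparator (isSeparator_toFactorCategory_obj hfin hT) _ fun t ht => ?_
  obtain ⟨t, rfl⟩ := (toFactorCategory T).map_surjective t
  rw [← Functor.map_comp] at ht
  have hti : t⟦(1 : ℤ)⟧' ≫ i⟦(1 : ℤ)⟧' = 0 := by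
    rw [← Functor.map_comp, eq_zero_of_toFactorCategory_map_eq_zero ht, Functor.map_zero]
  obtain ⟨g, hg⟩ : ∃ g : T⟦(1 : ℤ)⟧ ⟶ ⨁ fun _ : Fin n => S, t⟦(1 : ℤ)⟧' = g ≫ r :=
    Triangle.coyoneda_exact₁ _ hd _ hti
  have hg0 : g = 0 := biproduct.hom_ext _ _ fun _ => by
    rw [zero_comp]
    exact hτ.eq_zero_of_forall_hom_eq_zero hT _
  have ht0 : t = 0 := (shiftFunctor C (1 : ℤ)).map_injective <| by
    rw [hg, hg0, zero_comp, Functor.map_zero]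
  rw [ht0, Functor.map_zero]

lemma epi_map_of_distTriang {Y Q : C} {n : ℕ} {p : (⨁ fun _ : Fin n => T) ⟶ Y} {q : Y ⟶ Q}
    {r : Q ⟶ (⨁ fun _ : Fin n => T)⟦(1 : ℤ)⟧} (hd : Triangle.mk p q r ∈ distTriang C) :
    Epi ((toFactorCategory T).map q) := by
  refine epi_of_isCoseparator (hτ.isCoseparator_toFactorCategory_obj hfin hT) _ fun s hs => ?_
  obtain ⟨s, rfl⟩ := (toFactorCategory T).map_surjective s
  rw [← Functor.map_comp] at hs
  obtain ⟨g, rfl⟩ : ∃ g : (⨁ fun _ : Fin n => T)⟦(1 : ℤ)⟧ ⟶ S, s = r ≫ g :=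
    Triangle.yoneda_exact₃ _ hd s (hτ.eq_zero_of_map_eq_zero hs)
  have hg0 : g = 0 := eq_zero_of_map_biproduct_ι_comp (shiftFunctor C (1 : ℤ)) g fun _ =>
    hτ.eq_zero_of_forall_hom_eq_zero hT _
  rw [hg0, comp_zero, Functor.map_zero]

lemma hasCokernels_factorCategory : HasCokernels (FactorCategory T) where
  has_colimit := by
    rintro ⟨X⟩ ⟨Y⟩ f
    obtain ⟨f, rfl⟩ := (toFactorCategory T).map_surjective f
    obtain ⟨n, p, _⟩ := exists_epi_toFactorCategory_map hfin hT X
    obtain ⟨Q, q, r, hd⟩ := distinguished_cocone_triangle (p ≫ f)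
    have := hτ.epi_map_of_distTriang hfin hT hd
    have hpfq : (p ≫ f) ≫ q = 0 := comp_distTriang_mor_zero₁₂ _ hd
    have hfq : (toFactorCategory T).map f ≫ (toFactorCategory T).map q = 0 := by
      apply zero_of_epi_comp ((toFactorCategory T).map p)
      rw [← Category.assoc, ← Functor.map_comp, ← Functor.map_comp, hpfq, Functor.map_zero]
    refine ⟨⟨_, CokernelCofork.IsColimit.ofπ' _ hfq fun {W} w hw => Classical.choice ?_⟩⟩
    obtain ⟨W⟩ := W
    obtain ⟨w, rfl⟩ := (toFactorCategory T).map_surjective w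
    have hpfw : (p ≫ f) ≫ w = 0 := eq_zero_of_toFactorCategory_map_eq_zero_of_biproduct <| by
      rw [Functor.map_comp, Functor.map_comp, Category.assoc, hw, comp_zero]
    obtain ⟨l, rfl⟩ : ∃ l : Q ⟶ W, w = q ≫ l := Triangle.yoneda_exact₂ _ hd w hpfw
    exact ⟨(toFactorCategory T).map l, (Functor.map_comp _ _ _).symm⟩

variable [IsNoetherianRing k]

lemma exists_mono_toFactorCategory_map (Y : C) :
    ∃ (n : ℕ) (j : Y ⟶ ⨁ fun _ : Fin n => S), Mono ((toFactorCategory T).map j) := by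
  have := hτ.finite_hom Y
  obtain ⟨n, j, hj⟩ := exists_left_approximation k S Y
  refine ⟨n, j, Preadditive.mono_of_cancel_zero _ ?_⟩
  rintro ⟨W⟩ w hw
  obtain ⟨w, rfl⟩ := (toFactorCategory T).map_surjective w
  rw [← Functor.map_comp] at hw
  refine toFactorCategory_map_eq_zero_of_forall_comp_eq_zero (R := k) hT <|
    hτ.comp_eq_zero_of_forall_comp_eq_zero fun s => ?_
  obtain ⟨s, rfl⟩ := hj s
  rw [← Category.assoc, hτ.eq_zero_of_map_eq_zero_of_biproduct hw, zero_comp]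

lemma isKernelInjective_toFactorCategory_obj :
    IsKernelInjective ((toFactorCategory T).obj S) := by
  rintro ⟨X⟩ ⟨Y⟩ f g hfg
  obtain ⟨f, rfl⟩ := (toFactorCategory T).map_surjective f
  obtain ⟨g, rfl⟩ := (toFactorCategory T).map_surjective g
  obtain ⟨n, j, _⟩ := hτ.exists_mono_toFactorCategory_map hfin hT Y
  obtain ⟨K, i, r, hd⟩ := distinguished_cocone_triangle₁ (f ≫ j)
  have hifj : i ≫ f ≫ j = 0 := comp_distTriang_mor_zero₁₂ _ hd
  have hif : (toFactorCategory T).map i ≫ (toFactorCategory T).map f = 0 := by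
    apply zero_of_comp_mono ((toFactorCategory T).map j)
    rw [Category.assoc, ← Functor.map_comp, ← Functor.map_comp, hifj, Functor.map_zero]
  have hig : i ≫ g = 0 := hτ.eq_zero_of_map_eq_zero (by rw [Functor.map_comp, hfg _ hif])
  obtain ⟨e, rfl⟩ : ∃ e, g = (f ≫ j) ≫ e := Triangle.yoneda_exact₂ _ hd g hig
  exact ⟨(toFactorCategory T).map (j ≫ e), by rw [← Functor.map_comp, Category.assoc]⟩

lemma hasKernels_factorCategory : HasKernels (FactorCategory T) where
  has_limit := by
    rintro ⟨X⟩ ⟨Y⟩ f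
    obtain ⟨f, rfl⟩ := (toFactorCategory T).map_surjective f
    obtain ⟨n, j, _⟩ := hτ.exists_mono_toFactorCategory_map hfin hT Y
    obtain ⟨K, i, r, hd⟩ := distinguished_cocone_triangle₁ (f ≫ j)
    have := hτ.mono_map_of_distTriang hfin hT hd
    have hifj : i ≫ f ≫ j = 0 := comp_distTriang_mor_zero₁₂ _ hd
    have hif : (toFactorCategory T).map i ≫ (toFactorCategory T).map f = 0 := by
      apply zero_of_comp_mono ((toFactorCategory T).map j)
      rw [Category.assoc, ← Functor.map_comp, ← Functor.map_comp, hifj, Functor.map_zero]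
    refine ⟨⟨_, KernelFork.IsLimit.ofι' _ hif fun {W} w hw => Classical.choice ?_⟩⟩
    obtain ⟨W⟩ := W
    obtain ⟨w, rfl⟩ := (toFactorCategory T).map_surjective w
    have hwfj : w ≫ f ≫ j = 0 := hτ.eq_zero_of_map_eq_zero_of_biproduct <| by
      rw [Functor.map_comp, Functor.map_comp, ← Category.assoc, hw, zero_comp]
    obtain ⟨l, rfl⟩ : ∃ l : W ⟶ K, w = l ≫ i := Triangle.coyoneda_exact₂ _ hd w hwfj
    exact ⟨(toFactorCategory T).map l, (Functor.map_comp _ _ _).symm⟩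

lemma isPreabelian_factorCategory : IsPreabelian (FactorCategory T) where
  hasFiniteBiproducts := hasFiniteBiproducts_factorCategory T
  hasKernels := hτ.hasKernels_factorCategory hfin hT
  hasCokernels := hτ.hasCokernels_factorCategory hfin hT

end IsSerreTrace

end Rigid

theorem corollary3p9_general {k : Type*} [CommRing k] [IsNoetherianRing k] {C : Type u}
    [Category.{v} C] [Preadditive C] [Linear k C] [HasZeroObject C] [HasShift C ℤ]
    [∀ n : ℤ, (shiftFunctor C n).Additive] [Pretriangulated C] {T S : C}
    {τ : Module.Dual k (T ⟶ S)} (hτ : IsSerreTrace τ)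
    (hfin : ∀ X : C, Module.Finite k (T ⟶ X)) (hT : IsRigidObject T) :
    IsIntegralCategory (FactorCategory T) :=
  have hA := hτ.isPreabelian_factorCategory hfin hT
  have := hA.hasFiniteBiproducts
  have := hasBinaryBiproducts_of_finite_biproducts (FactorCategory T)
  { preabelian := hA
    leftIntegral := pullbacksPreserveEpi_of_isCoseparator
      (hτ.isCoseparator_toFactorCategory_obj hfin hT)
      (hτ.isKernelInjective_toFactorCategory_obj hfin hT)
    rightIntegral := pushoutsPreserveMono_of_isSeparator
      (isSeparator_toFactorCategory_obj hfin hT)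
      (isCokernelProjective_toFactorCategory_obj hfin hT) }

theorem corollary3p9 {k : Type w} [Field k] {C : Type u} [Category.{v} C] [EssentiallySmall.{v} C]
    [Preadditive C] [Linear k C] [HasZeroObject C] [HasShift C ℤ]
    [∀ n : ℤ, (shiftFunctor C n).Additive] [∀ n : ℤ, (shiftFunctor C n).Linear k]
    [Pretriangulated C] [IsTriangulated C]
    (hHomFinite : ∀ X Y : C, Module.Finite k (X ⟶ Y))
    (hKrullSchmidt : IsKrullSchmidt C)
    (hSerre : Nonempty (SerreDuality k C))
    (T : C) (hT : IsRigidObject T) :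
    IsIntegralCategory (FactorCategory T) := by
  obtain ⟨D⟩ := hSerre
  exact corollary3p9_general (D.isSerreTrace T) (hHomFinite T) hT
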